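/- Let $\mu>0$ and let $U,W:\mathbb{R}^d\to\mathbb{R}$ satisfy: (A) $U$ and $W$ are $-\Delta$-bounded with relative bound zero: for $X=U,W$, the domain $\{g\in L^2(\mathbb{R}^d): Xg\in L^2(\mathbb{R}^d)\}$ of multiplication by $X$ contains the Sobolev space $H^2(\mathbb{R}^d)=\mathcal{D}(-\Delta)$, and for every $\varepsilon>0$ there is a constant $C_\varepsilon$ with $\|Xg\|_2\le\varepsilon\|-\Delta g\|_2+C_\varepsilon\|g\|_2$ for all $g\in H^2(\mathbb{R}^d)$; (B) $U(x)\to0$ and $W(x)\to0$ as $|x|\to\infty$ (up to null sets; no rate is assumed). On $L^2(\mathbb{R}^d,\mathbb{C}^2)$ consider the operator $$\mathcal{H}=\begin{pmatrix}-\Delta+\mu+U & W\\ -W & \Delta-\mu-U\end{pmatrix},\qquad \mathcal{D}(\mathcal{H})=H^2(\mathbb{R}^d,\mathbb{C}^2).$$ Let $E\in\mathbb{C}$ be an eigenvalue of $\mathcal{H}$ with $-\mu<\operatorname{Re}E<\mu$. Then every eigenfunction and generalized eigenfunction of $\mathcal{H}$ for $E$ decays exponentially; precisely, if $k\in\mathbb{N}$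 and $\varphi$ in the natural domain of $(\mathcal{H}-E)^k$ satisfies $(\mathcal{H}-E)^k\varphi=0$, then $$e^{\sqrt{\mu-|\operatorname{Re}E|-2\delta}\,|x|}\,\varphi\in L^2(\mathbb{R}^d,\mathbb{C}^2)\qquad\text{for all } 0<\delta<\tfrac12\bigl(\mu-|\operatorname{Re}E|\bigr).$$ -/

import Mathlib

namespace MatrixSchrodinger

open MeasureTheory Filter Topology TemperedDistribution
open scoped SchwartzMap Laplacian

noncomputable section

/-- Euclidean space `ℝ^d`. -/
abbrev Rd (d : ℕ) : Type := EuclideanSpace ℝ (Fin d)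

/-- `ℂ²` with its Euclidean norm. -/
abbrev C2 : Type := EuclideanSpace ℂ (Fin 2)

/-- `L²(ℝ^d) = L²(ℝ^d, ℂ)`. -/
abbrev L2 (d : ℕ) : Type := Lp ℂ 2 (volume : Measure (Rd d))

/-- `L²(ℝ^d, ℂ²)`. -/
abbrev L2C2 (d : ℕ) : Type := Lp C2 2 (volume : Measure (Rd d))

/-! ### Unbounded operators -/

/-- The product `g f` of two unbounded operators on its natural domain
`{x ∈ D(f) | f x ∈ D(g)}`. -/
def opComp {H : Type*} [AddCommGroup H] [Module ℂ H] (g f : H →ₗ.[ℂ] H) : H →ₗ.[ℂ] H :=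
  g.comp (f.domRestrict ((g.domain.comap f.toFun).map f.domain.subtype)) (by
    rintro ⟨x, hx⟩
    obtain ⟨⟨y, hy, rfl⟩, -⟩ := id hx
    exact hy)

/-- The powers `T^k` of an unbounded operator on their natural domains:
`T^0 = 1` and `D(T^(k+1)) = {x ∈ D(T) | T x ∈ D(T^k)}`. -/
def opPow {H : Type*} [AddCommGroup H] [Module ℂ H] (T : H →ₗ.[ℂ] H) : ℕ → H →ₗ.[ℂ] H
  | 0 => LinearMap.id.toPMap ⊤
  | k + 1 => opComp (opPow T k) T

/-- The scalar operator `c · 1`, defined everywhere. -/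
def scalarOp (H : Type*) [AddCommGroup H] [Module ℂ H] (c : ℂ) : H →ₗ.[ℂ] H :=
  (c • (LinearMap.id : H →ₗ[ℂ] H)).toPMap ⊤

/-- `E` is an eigenvalue of the unbounded operator `T`. -/
def IsEigenvalue {H : Type*} [AddCommGroup H] [Module ℂ H] (T : H →ₗ.[ℂ] H) (E : ℂ) : Prop :=
  ∃ ψ : T.domain, (ψ : H) ≠ 0 ∧ T ψ = E • (ψ : H)

/-! ### The Laplacian on `H²(ℝ^d)` -/

/-- The Sobolev space `H²(ℝ^d)`, as a subspace of `L²(ℝ^d)`. -/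
def sobolevH2 (d : ℕ) : Submodule ℂ (L2 d) where
  carrier := {g | MemSobolev 2 2 (g : 𝓢'(Rd d, ℂ))}
  zero_mem' := by
    have := memSobolev_fun_zero (Rd d) ℂ 2 2
    rwa [← map_zero (Lp.toTemperedDistributionCLM ℂ (volume : Measure (Rd d)) 2)] at this
  add_mem' {f g} hf hg := by
    have := MemSobolev.add hf hg
    rwa [← Lp.toTemperedDistributionCLM_apply, ← Lp.toTemperedDistributionCLM_apply g,
      ← map_add] at this
  smul_mem' c f hf := by
    have := MemSobolev.smul c hf
    rwa [← Lp.toTemperedDistributionCLM_apply, ← map_smul] at this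

theorem toTemperedDistribution_injective (d : ℕ) {f g : L2 d}
    (h : (f : 𝓢'(Rd d, ℂ)) = (g : 𝓢'(Rd d, ℂ))) : f = g :=
  LinearMap.ker_eq_bot.mp
    (Lp.ker_toTemperedDistributionCLM_eq_bot (F := ℂ) (p := 2) (μ := (volume : Measure (Rd d)))) h

/-- The distributional Laplacian of an `H²` function is (represented by) an `L²` function. -/
theorem exists_laplacian {d : ℕ} (g : sobolevH2 d) :
    ∃ h : L2 d, (h : 𝓢'(Rd d, ℂ)) = Δ ((g : L2 d) : 𝓢'(Rd d, ℂ)) := by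
  have h : MemSobolev 2 2 ((g : L2 d) : 𝓢'(Rd d, ℂ)) := g.2
  have := h.laplacian
  rw [sub_self, memSobolev_zero_iff] at this
  obtain ⟨h, hh⟩ := this
  exact ⟨h, hh.symm⟩

/-- The Laplacian `Δ` in `L²(ℝ^d)` with domain `H²(ℝ^d)`: `Δ g` is the `L²` function that
represents the distributional Laplacian of `g`. -/
def laplacianOp (d : ℕ) : L2 d →ₗ.[ℂ] L2 d where
  domain := sobolevH2 d
  toFun :=
    { toFun := fun g => (exists_laplacian g).choose
      map_add' := fun f g => by
        apply toTemperedDistribution_injective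
        have hf := (exists_laplacian f).choose_spec
        have hg := (exists_laplacian g).choose_spec
        rw [(exists_laplacian (f + g)).choose_spec]
        simp only [← Lp.toTemperedDistributionCLM_apply, ← laplacianCLM_apply] at hf hg ⊢
        rw [map_add, hf, hg, Submodule.coe_add, map_add, map_add]
      map_smul' := fun c f => by
        apply toTemperedDistribution_injective
        have hf := (exists_laplacian f).choose_spec
        rw [(exists_laplacian (c • f)).choose_spec]
        simp only [← Lp.toTemperedDistributionCLM_apply, ← laplacianCLM_apply] at hf ⊢
        rw [RingHom.id_apply, map_smul, hf, Submodule.coe_smul, map_smul, map_smul] }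

/-! ### Multiplication operators -/

theorem mul_add_ae {d : ℕ} (X : Rd d → ℝ) (f g : L2 d) :
    (fun x => (X x : ℂ) * (f + g : L2 d) x) =ᵐ[volume]
      (fun x => (X x : ℂ) * f x) + fun x => (X x : ℂ) * g x := by
  filter_upwards [Lp.coeFn_add f g] with x hx
  rw [hx, Pi.add_apply, Pi.add_apply, mul_add]

theorem mul_smul_ae {d : ℕ} (X : Rd d → ℝ) (c : ℂ) (f : L2 d) :
    (fun x => (X x : ℂ) * (c • f : L2 d) x) =ᵐ[volume] c • fun x => (X x : ℂ) * f x := by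
  filter_upwards [Lp.coeFn_smul c f] with x hx
  rw [hx, Pi.smul_apply, Pi.smul_apply, smul_eq_mul, smul_eq_mul, mul_left_comm]

/-- The maximal domain `{g ∈ L² | X g ∈ L²}` of multiplication by `X` in `L²(ℝ^d)`. -/
def mulDomain {d : ℕ} (X : Rd d → ℝ) : Submodule ℂ (L2 d) where
  carrier := {g | MemLp (fun x => (X x : ℂ) * g x) 2 volume}
  zero_mem' := by
    refine (memLp_congr_ae ?_).mpr (MemLp.zero (ε := ℂ))
    filter_upwards [Lp.coeFn_zero ℂ 2 (volume : Measure (Rd d))] with x hx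
    rw [hx, Pi.zero_apply, mul_zero]
  add_mem' {f g} hf hg := (memLp_congr_ae (mul_add_ae X f g)).mpr (MemLp.add hf hg)
  smul_mem' c f hf := (memLp_congr_ae (mul_smul_ae X c f)).mpr (MemLp.const_smul hf c)

theorem mem_mulDomain {d : ℕ} {X : Rd d → ℝ} {g : L2 d} :
    g ∈ mulDomain X ↔ MemLp (fun x => (X x : ℂ) * g x) 2 volume :=
  Iff.rfl

/-- The product `X g` as an element of `L²(ℝ^d)`. -/
def mulFun {d : ℕ} (X : Rd d → ℝ) (g : mulDomain X) : L2 d :=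
  MemLp.toLp (fun x => (X x : ℂ) * (g : L2 d) x) (mem_mulDomain.mp g.2)

theorem coeFn_mulFun {d : ℕ} (X : Rd d → ℝ) (g : mulDomain X) :
    mulFun X g =ᵐ[volume] fun x => (X x : ℂ) * (g : L2 d) x :=
  MemLp.coeFn_toLp _

theorem mulFun_add {d : ℕ} (X : Rd d → ℝ) (f g : mulDomain X) :
    mulFun X (f + g) = mulFun X f + mulFun X g := by
  apply Lp.ext
  filter_upwards [coeFn_mulFun X (f + g), coeFn_mulFun X f, coeFn_mulFun X g,
    Lp.coeFn_add (mulFun X f) (mulFun X g), mul_add_ae X f g] with x h₁ h₂ h₃ h₄ h₅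
  rw [h₁, h₄, Pi.add_apply, h₂, h₃]
  exact h₅

theorem mulFun_smul {d : ℕ} (X : Rd d → ℝ) (c : ℂ) (f : mulDomain X) :
    mulFun X (c • f) = c • mulFun X f := by
  apply Lp.ext
  filter_upwards [coeFn_mulFun X (c • f), coeFn_mulFun X f,
    Lp.coeFn_smul c (mulFun X f), mul_smul_ae X c f] with x h₁ h₂ h₃ h₄
  rw [h₁, h₃, Pi.smul_apply, h₂]
  exact h₄

/-- The multiplication operator `g ↦ X g` in `L²(ℝ^d)` with its maximal domain. -/
def mulOp {d : ℕ} (X : Rd d → ℝ) : L2 d →ₗ.[ℂ] L2 d where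
  domain := mulDomain X
  toFun :=
    { toFun := mulFun X
      map_add' := mulFun_add X
      map_smul' := mulFun_smul X }

/-- `X` is `-Δ`-bounded with relative bound zero. -/
def IsLaplacianBoundedWithBoundZero {d : ℕ} (X : Rd d → ℝ) : Prop :=
  ∃ h : (laplacianOp d).domain ≤ (mulOp X).domain,
    ∀ ε : ℝ, 0 < ε → ∃ C : ℝ, ∀ g : (laplacianOp d).domain,
      ‖mulOp X ⟨g, h g.2⟩‖ ≤ ε * ‖(-laplacianOp d) g‖ + C * ‖(g : L2 d)‖

/-- `X(x) → 0` as `|x| → ∞`, up to a Lebesgue null set. -/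
def TendsToZeroAtInfinity {d : ℕ} (X : Rd d → ℝ) : Prop :=
  Tendsto X (cocompact (Rd d) ⊓ ae volume) (𝓝 0)

/-! ### The matrix operator -/

/-- The `j`-th component of an element of `L²(ℝ^d, ℂ²)`. -/
def component {d : ℕ} (j : Fin 2) : L2C2 d →L[ℂ] L2 d :=
  (EuclideanSpace.proj j : C2 →L[ℂ] ℂ).compLpL 2 volume

/-- The element of `L²(ℝ^d, ℂ²)` with the given function as `i`-th component and `0` as the
other one. -/
def inclusion {d : ℕ} (i : Fin 2) : L2 d →L[ℂ] L2C2 d :=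
  (ContinuousLinearMap.toSpanSingleton ℂ (EuclideanSpace.single i (1 : ℂ) : C2)).compLpL 2 volume

/-- The operator in `L²(ℝ^d, ℂ²)` given by a `2 × 2` matrix of operators in `L²(ℝ^d)`,
`(A φ)_i = ∑_j A_{ij} φ_j`, on the domain `{φ | φ_j ∈ D(A_{ij}) for all i, j}`. -/
def matrixOp {d : ℕ} (A : Fin 2 → Fin 2 → (L2 d →ₗ.[ℂ] L2 d)) : L2C2 d →ₗ.[ℂ] L2C2 d where
  domain := ⨅ i, ⨅ j, (A i j).domain.comap (component j).toLinearMap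
  toFun :=
    { toFun := fun φ => ∑ i, inclusion i (∑ j, A i j ⟨component j (φ : L2C2 d), by
        have := φ.2
        simp only [Submodule.mem_iInf] at this
        exact this i j⟩)
      map_add' := fun φ ψ => by
        simp only [← Finset.sum_add_distrib, ← map_add]
        congr! 4 with i _ j _
        rw [← LinearPMap.map_add]
        congr 1
        ext1
        simp
      map_smul' := fun c φ => by
        simp only [Finset.smul_sum, ← map_smul, RingHom.id_apply]
        congr! 4 with i _ j _
        rw [← LinearPMap.map_smul]
        congr 1
        ext1
        simp }

/-- The system
`ℋ = (-Δ + μ + U, W; -W, Δ - μ - U)` in `L²(ℝ^d, ℂ²)`. All sums carry their natural domains; when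
`H²(ℝ^d) ⊆ D(U) ∩ D(W)`, the domain of `ℋ` is `H²(ℝ^d, ℂ²)`
(see `mem_systemOp_domain`). -/
def systemOp {d : ℕ} (μ : ℝ) (U W : Rd d → ℝ) : L2C2 d →ₗ.[ℂ] L2C2 d :=
  matrixOp
    ![![-laplacianOp d + scalarOp (L2 d) μ + mulOp U, mulOp W],
      ![-mulOp W, laplacianOp d - scalarOp (L2 d) μ - mulOp U]]

theorem mem_systemOp_domain {d : ℕ} (μ : ℝ) {U W : Rd d → ℝ}
    (hU : IsLaplacianBoundedWithBoundZero U) (hW : IsLaplacianBoundedWithBoundZero W)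
    (φ : L2C2 d) :
    φ ∈ (systemOp μ U W).domain ↔
      component 0 φ ∈ sobolevH2 d ∧ component 1 φ ∈ sobolevH2 d := by
  obtain ⟨hU, -⟩ := hU
  obtain ⟨hW, -⟩ := hW
  have key : ∀ j, component j φ ∈ (laplacianOp d).domain ↔ component j φ ∈ sobolevH2 d :=
    fun _ => Iff.rfl
  simp only [systemOp, matrixOp, Submodule.mem_iInf, Fin.forall_fin_two, Submodule.mem_comap,
    Matrix.cons_val_zero, Matrix.cons_val_one, LinearPMap.add_domain, LinearPMap.sub_domain,
    LinearPMap.neg_domain, Submodule.mem_inf, scalarOp, LinearMap.toPMap_domain,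
    Submodule.mem_top, and_true, ← key, ContinuousLinearMap.coe_coe]
  constructor
  · rintro ⟨⟨⟨h0, _⟩, _⟩, _, h1, _⟩
    exact ⟨h0, h1⟩
  · rintro ⟨h0, h1⟩
    exact ⟨⟨⟨h0, hU h0⟩, hW h1⟩, hW h0, h1, hU h1⟩

end

end MatrixSchrodinger

/-! This is an Agmon-type energy argument, with no resolvent or spectral theory. For a bounded real
weight `χ` with `|∇χ| ≤ a|χ|`, integration by parts gives `Re⟨χ²g, -Δg⟩ = ‖∇(χg)‖² - ‖g∇χ‖² ≥
-a²‖χg‖²`; this is `weighted_form_nonneg`.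

Write `φ = (u, v)` and `ψ = (ℋ - E)φ`, solve the first row for `Δu` and the second for `Δv`, and add
the two form densities. The opposite signs of the rows leave `Re E (|u|² - |v|²)`, which costs at
most `|Re E| |φ|²`. With `a² = μ - |Re E| - 2δ` and `|U| + |W| ≤ δ` near infinity, the sum is at
most `-(δ/2)|φ|² + (2δ)⁻¹|ψ|²` there (`inner_add_inner_le`). Its weighted integral is nonnegative,
so `∫ χ²|φ|²` is controlled by `∫ χ²|ψ|²` and a contribution from a ball. Inside the ball only `u`,
`v`, `Δu`, `Δv ∈ L²` matter, so local singularities of the potentials are harmless.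

The weights `expWeight a ε` are bounded for each `ε > 0`, satisfy the gradient bound with the same
`a`, and increase to an exponential as `ε` decreases to `0`. All estimates are uniform in `ε`, and
Fatou removes the cut-off. Thus `φ` inherits the decay of `ψ` at the same rate `a`, and induction on
`k` treats generalized eigenfunctions without loss in the exponent. -/

namespace MatrixSchrodinger

open MeasureTheory Filter Topology TemperedDistribution
open scoped SchwartzMap Laplacian LineDeriv FourierTransform

noncomputable section

section Density

/-! ### Density of Schwartz functions in `H²` -/

/-- A Fourier multiplier with bounded smooth symbol is a bounded operator on `L²`. -/
theorem exists_fourierMultiplier_clm (d : ℕ) {g : Rd d → ℂ} (hg : g.HasTemperateGrowth)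
    {C : ℝ} (hC : ∀ x, ‖g x‖ ≤ C) :
    ∃ T : L2 d →L[ℂ] L2 d, ∀ f : L2 d,
      (T f : 𝓢'(Rd d, ℂ)) = fourierMultiplierCLM ℂ g (f : 𝓢'(Rd d, ℂ)) := by
  have hmem : MemLp g ⊤ (volume : Measure (Rd d)) :=
    memLp_top_of_bound hg.1.continuous.aestronglyMeasurable C (ae_of_all _ hC)
  let F := (Lp.fourierTransformₗᵢ (Rd d) ℂ)
  let M : L2 d →L[ℂ] L2 d :=
    (ContinuousLinearMap.lsmul ℂ ℂ).holderL volume ⊤ 2 2 (hmem.toLp g)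
  refine ⟨F.symm.toContinuousLinearEquiv.toContinuousLinearMap ∘L M ∘L
    F.toContinuousLinearEquiv.toContinuousLinearMap, fun f => ?_⟩
  have h1 : (F.symm.toContinuousLinearEquiv.toContinuousLinearMap ∘L M ∘L
    F.toContinuousLinearEquiv.toContinuousLinearMap) f = 𝓕⁻ (hmem.toLp g • 𝓕 f) := rfl
  rw [h1, ← Lp.fourierInv_toTemperedDistribution_eq, Lp.toTemperedDistribution_smul_eq hg,
    ← Lp.fourier_toTemperedDistribution_eq, fourierMultiplierCLM_apply]

/-- A closed relation that holds between `v` and `Δ v` for Schwartz functions `v` holds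
for all `v ∈ H²`. -/
theorem sobolevH2_induction {d : ℕ} {P : L2 d → L2 d → Prop}
    (hP : IsClosed {p : L2 d × L2 d | P p.1 p.2})
    (h : ∀ v : 𝓢(Rd d, ℂ), P (v.toLp 2) ((Δ v).toLp 2)) (g : (laplacianOp d).domain) :
    P g (laplacianOp d g) := by
  obtain ⟨f, hf⟩ : MemSobolev 2 2 ((g : L2 d) : 𝓢'(Rd d, ℂ)) := g.2
  have hL : (laplacianOp d g : 𝓢'(Rd d, ℂ)) = Δ ((g : L2 d) : 𝓢'(Rd d, ℂ)) :=
    (exists_laplacian g).choose_spec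
  have hg : ((g : L2 d) : 𝓢'(Rd d, ℂ)) = besselPotential (Rd d) ℂ (-2) f := by
    rw [eq_comm, besselPotential_neg_apply_eq_iff, hf]
  -- Every `g ∈ H²` is a Bessel potential `T₁ f` of some `f ∈ L²`, with symbol `s = 1/(1 + |x|²)`.
  -- The symbol of `Δ T₁` is `-(2π)²|x|²/(1 + |x|²)`, again bounded, so both `g` and `Δg` depend
  -- continuously on `f`.
  set s : Rd d → ℝ := fun x => (1 + ‖x‖ ^ 2) ^ (-2 / 2 : ℝ) with hs
  have hst : (fun x => (s x : ℂ)).HasTemperateGrowth := by fun_prop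
  have hs' : ∀ x, s x = (1 + ‖x‖ ^ 2)⁻¹ := fun x => by
    rw [hs]; norm_num [Real.rpow_neg_one]
  have hnt : (fun x : Rd d => ((‖x‖ ^ 2 : ℝ) : ℂ)).HasTemperateGrowth := by fun_prop
  obtain ⟨T₁, hT₁⟩ := exists_fourierMultiplier_clm d hst (C := 1) fun x => by
    rw [Complex.norm_real, hs', Real.norm_of_nonneg (by positivity)]
    exact inv_le_one_of_one_le₀ (by simp)
  obtain ⟨T₂, hT₂⟩ := exists_fourierMultiplier_clm d (hst.mul hnt) (C := 1) fun x => by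
    simp only [norm_mul, Complex.norm_real, Pi.mul_apply]
    rw [hs', Real.norm_of_nonneg (by positivity), Real.norm_of_nonneg (by positivity),
      inv_mul_le_iff₀ (by positivity)]
    simp
  set c : ℂ := ((-(2 * Real.pi) ^ 2 : ℝ) : ℂ)
  have hΔ : ∀ w : L2 d, (((c • T₂) w : L2 d) : 𝓢'(Rd d, ℂ)) =
      Δ ((T₁ w : L2 d) : 𝓢'(Rd d, ℂ)) := fun w => by
    rw [laplacian_eq_fourierMultiplierCLM, hT₁,
      fourierMultiplierCLM_fourierMultiplierCLM_apply hst hnt, _root_.smul_apply,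
      ← Lp.toTemperedDistributionCLM_apply, map_smul, Lp.toTemperedDistributionCLM_apply, hT₂]
    exact Complex.coe_smul _ _
  -- Pulled back along `T₁` and `c • T₂`, the relation is a closed condition on all of `L²`. Density
  -- of Schwartz functions in `L²` now suffices, because `T₁` maps Schwartz functions to Schwartz
  -- functions.
  have key : ∀ w : L2 d, P (T₁ w) ((c • T₂) w) := by
    intro w
    have hcl : IsClosed {w : L2 d | P (T₁ w) ((c • T₂) w)} :=
      hP.preimage (T₁.continuous.prodMk (c • T₂).continuous)
    refine (SchwartzMap.denseRange_toLpCLM (E := Rd d) (F := ℂ) (p := 2) (μ := volume)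
      (by norm_num)).induction_on (p := fun w => P (T₁ w) ((c • T₂) w)) w hcl fun v => ?_
    rw [SchwartzMap.toLpCLM_apply]
    set v' := SchwartzMap.fourierMultiplierCLM ℂ (fun x => (s x : ℂ)) v
    have e1 : T₁ (v.toLp 2) = v'.toLp 2 := by
      apply toTemperedDistribution_injective
      rw [hT₁, Lp.toTemperedDistribution_toLp_eq, Lp.toTemperedDistribution_toLp_eq,
        fourierMultiplierCLM_toTemperedDistributionCLM_eq hst]
    have e2 : (c • T₂) (v.toLp 2) = (Δ v').toLp 2 := by
      apply toTemperedDistribution_injective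
      rw [hΔ, e1, Lp.toTemperedDistribution_toLp_eq, Lp.toTemperedDistribution_toLp_eq,
        laplacian_toTemperedDistributionCLM_eq]
    rw [e1, e2]
    exact h v'
  have e1 : (g : L2 d) = T₁ f := by
    apply toTemperedDistribution_injective
    rw [hg, hT₁, besselPotential]
  have e2 : laplacianOp d g = (c • T₂) f := by
    apply toTemperedDistribution_injective
    rw [hL, hΔ, e1]
  rw [e1, e2]
  exact key f

end Density

section FormInequality

/-! ### A weighted form inequality for the Laplacian -/

theorem integrable_mul_inner {d : ℕ} {F : Type*} [NormedAddCommGroup F] [InnerProductSpace ℝ F]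
    {m : Rd d → ℝ} {C : ℝ} (hm : Continuous m)
    (hC : ∀ x, |m x| ≤ C) {p q : Rd d → F} (hp : MemLp p 2 volume) (hq : MemLp q 2 volume) :
    Integrable (fun x => m x * inner ℝ (p x) (q x)) volume := by
  refine Integrable.bdd_mul (c := C) ?_ hm.aestronglyMeasurable (ae_of_all _ hC)
  refine (L2.integrable_inner (𝕜 := ℝ) (hp.toLp p) (hq.toLp q)).congr ?_
  filter_upwards [hp.coeFn_toLp, hq.coeFn_toLp] with x h₁ h₂
  rw [h₁, h₂]

variable {d : ℕ} {χ : Rd d → ℝ} {a C : ℝ}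

/-- With `w = ∂ₑv`, integration by parts turns the left side into `-∫ (χ²|w|² + 2χ ∂ₑχ Re⟨v, w⟩)`.
Completing the square with `|χw + (∂ₑχ)v|² ≥ 0` leaves only `(∂ₑχ)²|v|²`. -/
theorem integral_inner_lineDeriv_schwartz (hχ : ContDiff ℝ 1 χ) (hC : ∀ x, |χ x| ≤ C)
    (ha : ∀ x, ‖fderiv ℝ χ x‖ ≤ a * |χ x|) (v : 𝓢(Rd d, ℂ)) (e : Rd d) :
    ∫ x, χ x ^ 2 * inner ℝ (v x) ((∂_{e} (∂_{e} v)) x) ≤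
      ∫ x, (fderiv ℝ χ x e) ^ 2 * ‖v x‖ ^ 2 := by
  have hC0 : 0 ≤ C := (abs_nonneg _).trans (hC 0)
  set w : 𝓢(Rd d, ℂ) := ∂_{e} v
  have hχd : Differentiable ℝ χ := hχ.differentiable one_ne_zero
  have hχ' : Continuous fun x => fderiv ℝ χ x e :=
    (hχ.continuous_fderiv one_ne_zero).clm_apply continuous_const
  have hb' : ∀ x, |fderiv ℝ χ x e| ≤ |a| * C * ‖e‖ := fun x => by
    refine ((fderiv ℝ χ x).le_opNorm e).trans ?_
    gcongr
    calc ‖fderiv ℝ χ x‖ ≤ a * |χ x| := ha x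
      _ ≤ |a| * C := by gcongr; exacts [le_abs_self a, hC x]
  have hL : ∀ v : 𝓢(Rd d, ℂ), MemLp v 2 volume := fun v => v.memLp 2
  have i0 : ∀ p q : 𝓢(Rd d, ℂ), Integrable (fun x => χ x ^ 2 * inner ℝ (p x) (q x)) := fun p q =>
    integrable_mul_inner (m := fun x => χ x ^ 2) (C := C ^ 2) (hχ.continuous.pow 2) (fun x => by
      rw [abs_pow]; gcongr; exact hC x) (hL p) (hL q)
  have i1 : Integrable (fun x => (χ x * fderiv ℝ χ x e) * inner ℝ (v x) (w x)) :=
    integrable_mul_inner (m := fun x => χ x * fderiv ℝ χ x e) (C := C * (|a| * C * ‖e‖)) (hχ.continuous.mul hχ') (fun x => by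
      rw [abs_mul]; gcongr; exacts [hC x, hb' x]) (hL v) (hL w)
  have i2 : Integrable (fun x => (fderiv ℝ χ x e) ^ 2 * ‖v x‖ ^ 2) := by
    simp_rw [← real_inner_self_eq_norm_sq]
    exact integrable_mul_inner (m := fun x => fderiv ℝ χ x e ^ 2) (C := (|a| * C * ‖e‖) ^ 2) (hχ'.pow 2) (fun x => by
      rw [abs_pow]; gcongr; exact hb' x) (hL v) (hL v)
  have hder : ∀ x, HasFDerivAt (fun x => χ x ^ 2 • v x)
      ((χ x ^ 2) • fderiv ℝ v x + ((2 * χ x) • fderiv ℝ χ x).smulRight (v x)) x := fun x => by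
    have h1 : HasFDerivAt (fun x => χ x ^ 2) ((2 * χ x) • fderiv ℝ χ x) x := by
      simpa using (hχd x).hasFDerivAt.pow 2
    exact h1.smul (v.differentiableAt.hasFDerivAt)
  have heq : ∀ x, inner ℝ (((χ x ^ 2) • fderiv ℝ v x +
      ((2 * χ x) • fderiv ℝ χ x).smulRight (v x)) e) (w x) =
      χ x ^ 2 * inner ℝ (w x) (w x) + 2 * ((χ x * fderiv ℝ χ x e) * inner ℝ (v x) (w x)) := by
    intro x
    have : fderiv ℝ v x e = w x := (SchwartzMap.lineDerivOp_apply_eq_fderiv e v x).symm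
    simp only [add_apply, smul_apply, ContinuousLinearMap.smulRight_apply, this,
      inner_add_left, real_inner_smul_left, smul_eq_mul]
    ring
  obtain ⟨B, hB⟩ : ∃ B : ℂ →L[ℝ] ℂ →L[ℝ] ℝ, ∀ x y, B x y = inner ℝ x y :=
    ⟨innerSL ℝ, fun _ _ => rfl⟩
  have ibp := integral_bilinear_hasFDerivAt_right_eq_neg_left_of_integrable (μ := volume)
    (B := B) (f := fun x => χ x ^ 2 • v x) (g := w) (g' := fderiv ℝ w) (v := e)
    (f' := fun x => (χ x ^ 2) • fderiv ℝ v x + ((2 * χ x) • fderiv ℝ χ x).smulRight (v x))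
    (by simp only [hB, heq]; exact (i0 w w).add (i1.const_mul 2))
    (by
      simp only [hB, real_inner_smul_left,
        ← SchwartzMap.lineDerivOp_apply_eq_fderiv]
      exact i0 v _)
    (by simp only [hB, real_inner_smul_left]; exact i0 v w)
    (fun x _ => hder x) (fun x _ => w.differentiableAt.hasFDerivAt)
  simp only [hB, heq, real_inner_smul_left,
    ← SchwartzMap.lineDerivOp_apply_eq_fderiv] at ibp
  rw [ibp, ← integral_neg]
  refine integral_mono ((i0 w w).add (i1.const_mul 2)).neg i2 fun x => ?_
  have := real_inner_self_nonneg (x := χ x • w x + (fderiv ℝ χ x e) • v x)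
  simp only [inner_add_left, inner_add_right, real_inner_smul_left, real_inner_smul_right,
    real_inner_self_eq_norm_sq, real_inner_comm (v x) (w x), norm_smul, mul_pow,
    Real.norm_eq_abs, sq_abs] at this
  simp only [real_inner_self_eq_norm_sq]
  linarith

theorem sum_sq_fderiv_le (ha : ∀ x, ‖fderiv ℝ χ x‖ ≤ a * |χ x|) (x : Rd d) :
    ∑ i, (fderiv ℝ χ x (EuclideanSpace.basisFun (Fin d) ℝ i)) ^ 2 ≤ a ^ 2 * χ x ^ 2 := by
  have h : ∀ e, fderiv ℝ χ x e =
      inner ℝ ((InnerProductSpace.toDual ℝ (Rd d)).symm (fderiv ℝ χ x)) e := fun e =>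
    InnerProductSpace.toDual_symm_apply.symm
  simp_rw [h]
  rw [OrthonormalBasis.sum_sq_inner_left, LinearIsometryEquiv.norm_map, ← mul_pow,
    ← sq_abs (a * χ x)]
  gcongr
  refine (ha x).trans ?_
  rw [abs_mul]
  gcongr
  exact le_abs_self a

/-- Summing the directional estimates over an orthonormal basis bounds `Re⟨χ²v, Δv⟩` by `∫
|∇χ|²|v|²`, hence by `a² ∫ χ²|v|²`. -/
theorem weighted_form_nonneg_schwartz (hχ : ContDiff ℝ 1 χ) (hC : ∀ x, |χ x| ≤ C)
    (ha : ∀ x, ‖fderiv ℝ χ x‖ ≤ a * |χ x|) (v : 𝓢(Rd d, ℂ)) :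
    0 ≤ ∫ x, χ x ^ 2 * inner ℝ (v x) ((a : ℂ) ^ 2 * v x - (Δ v) x) := by
  have hC0 : 0 ≤ C := (abs_nonneg _).trans (hC 0)
  have hL : ∀ v : 𝓢(Rd d, ℂ), MemLp v 2 volume := fun v => v.memLp 2
  have i0 : ∀ p q : 𝓢(Rd d, ℂ), Integrable (fun x => χ x ^ 2 * inner ℝ (p x) (q x)) := fun p q =>
    integrable_mul_inner (m := fun x => χ x ^ 2) (C := C ^ 2) (hχ.continuous.pow 2) (fun x => by
      rw [abs_pow]; gcongr; exact hC x) (hL p) (hL q)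
  have hgrad := sum_sq_fderiv_le ha
  generalize EuclideanSpace.basisFun (Fin d) ℝ = b at hgrad
  have hχ' : ∀ e, Continuous fun x => fderiv ℝ χ x e := fun e =>
    (hχ.continuous_fderiv one_ne_zero).clm_apply continuous_const
  have i1 : Integrable fun x => (a ^ 2 * χ x ^ 2) * ‖v x‖ ^ 2 := by
    simp_rw [← real_inner_self_eq_norm_sq, mul_assoc]
    exact (i0 v v).const_mul _
  have i2 : ∀ i, Integrable fun x => (fderiv ℝ χ x (b i)) ^ 2 * ‖v x‖ ^ 2 := fun i => by
    refine i1.mono' (((hχ' _).pow 2).mul (v.continuous.norm.pow 2)).aestronglyMeasurable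
      (ae_of_all _ fun x => ?_)
    rw [Real.norm_of_nonneg (by positivity)]
    gcongr
    exact (Finset.single_le_sum (fun i _ => sq_nonneg (fderiv ℝ χ x (b i)))
      (Finset.mem_univ i)).trans (hgrad x)
  have i3 : Integrable fun x => ∑ i, (fderiv ℝ χ x (b i)) ^ 2 * ‖v x‖ ^ 2 :=
    integrable_finsetSum _ fun i _ => i2 i
  have e1 : ∫ x, χ x ^ 2 * inner ℝ (v x) ((a : ℂ) ^ 2 * v x - (Δ v) x) =
      (∫ x, (a ^ 2 * χ x ^ 2) * ‖v x‖ ^ 2) -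
        ∑ i, ∫ x, χ x ^ 2 * inner ℝ (v x) ((∂_{b i} (∂_{b i} v)) x) := by
    rw [← integral_finsetSum _ fun i _ => i0 _ _,
      ← integral_sub i1 (integrable_finsetSum _ fun i _ => i0 _ _)]
    congr with x
    have : (a : ℂ) ^ 2 * v x = (a ^ 2 : ℝ) • v x := by simp
    rw [this, inner_sub_right, real_inner_smul_right, real_inner_self_eq_norm_sq,
      SchwartzMap.laplacian_eq_sum b, _root_.sum_apply, inner_sum, mul_sub, Finset.mul_sum]
    ring
  have e2 : ∫ x, ∑ i, (fderiv ℝ χ x (b i)) ^ 2 * ‖v x‖ ^ 2 =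
      ∑ i, ∫ x, (fderiv ℝ χ x (b i)) ^ 2 * ‖v x‖ ^ 2 := by
    rw [integral_finsetSum _ fun i _ => i2 i]
  rw [e1, sub_nonneg]
  refine (Finset.sum_le_sum fun i _ =>
    integral_inner_lineDeriv_schwartz hχ hC ha v (b i)).trans ?_
  rw [← e2]
  refine integral_mono i3 i1 fun x => ?_
  simp only [← Finset.sum_mul]
  exact mul_le_mul_of_nonneg_right (hgrad x) (sq_nonneg _)

/-- If `|∇χ| ≤ a |χ|`, then `Re ⟨χ² g, (a² - Δ) g⟩ ≥ 0` for all `g ∈ H²`. -/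
theorem weighted_form_nonneg (hχ : ContDiff ℝ 1 χ) (hC : ∀ x, |χ x| ≤ C)
    (ha : ∀ x, ‖fderiv ℝ χ x‖ ≤ a * |χ x|) (g : (laplacianOp d).domain) :
    0 ≤ ∫ x, χ x ^ 2 * inner ℝ ((g : L2 d) x) ((a : ℂ) ^ 2 * (g : L2 d) x - laplacianOp d g x) := by
  have hC0 : 0 ≤ C := (abs_nonneg _).trans (hC 0)
  have hmem : MemLp (fun x => ((χ x ^ 2 : ℝ) : ℂ)) ⊤ (volume : Measure (Rd d)) := by
    refine memLp_top_of_bound (by have := hχ.continuous; fun_prop) (C ^ 2) (ae_of_all _ fun x => ?_)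
    rw [Complex.norm_real, Real.norm_eq_abs, abs_pow]
    gcongr
    exact hC x
  -- Multiplication by `χ²` is bounded on `L²`, so the inequality is a closed condition on the pair
  -- `(g, Δg)`, as `sobolevH2_induction` requires.
  let M : L2 d →L[ℂ] L2 d :=
    (ContinuousLinearMap.lsmul ℂ ℂ).holderL volume ⊤ 2 2 (hmem.toLp _)
  have hM : ∀ u, M u =ᵐ[volume] fun x => ((χ x ^ 2 : ℝ) : ℂ) * u x := fun u => by
    have : M u = hmem.toLp _ • u := rfl
    rw [this]
    filter_upwards [Lp.coeFn_lpSMul (r := 2) (hmem.toLp _) u, hmem.coeFn_toLp] with x h1 h2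
    rw [h1, Pi.smul_apply', h2, smul_eq_mul]
  have hint : ∀ u l : L2 d, ∫ x, χ x ^ 2 * inner ℝ (u x) ((a : ℂ) ^ 2 * u x - l x) =
      inner ℝ (M u) ((a : ℂ) ^ 2 • u - l) := fun u l => by
    rw [L2.inner_def]
    refine integral_congr_ae ?_
    filter_upwards [hM u, Lp.coeFn_sub ((a : ℂ) ^ 2 • u) l, Lp.coeFn_smul ((a : ℂ) ^ 2) u]
      with x h1 h2 h3
    rw [h1, h2, Pi.sub_apply, h3, Pi.smul_apply, smul_eq_mul, ← Complex.real_smul,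
      real_inner_smul_left]
  rw [hint]
  refine sobolevH2_induction (P := fun u l => 0 ≤ inner ℝ (M u) ((a : ℂ) ^ 2 • u - l)) ?_ ?_ g
  · exact isClosed_le continuous_const (by fun_prop)
  · intro v
    rw [← hint]
    refine (weighted_form_nonneg_schwartz hχ hC ha v).trans_eq (integral_congr_ae ?_)
    filter_upwards [v.coeFn_toLp 2, (Δ v).coeFn_toLp 2] with x h1 h2
    rw [h1, h2]

end FormInequality

section Weights

/-! ### Bounded exponential weights -/

/-- The bounded smooth weight `exp (a s / (1 + ε s))` with `s = √(1 + |x|²)`. -/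
def expWeight {d : ℕ} (a ε : ℝ) (x : Rd d) : ℝ :=
  Real.exp (a * (√(1 + ‖x‖ ^ 2) / (1 + ε * √(1 + ‖x‖ ^ 2))))

section expWeight

variable {d : ℕ} {a ε : ℝ}

theorem expWeight_pos (x : Rd d) : 0 < expWeight a ε x := Real.exp_pos _

theorem contDiff_expWeight (hε : 0 < ε) : ContDiff ℝ 1 (expWeight (d := d) a ε) := by
  have hs : ContDiff ℝ 1 fun x : Rd d => √(1 + ‖x‖ ^ 2) :=
    ContDiff.sqrt (contDiff_const.add (contDiff_norm_sq ℝ)) fun x => by positivity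
  exact (contDiff_const.mul (hs.div (contDiff_const.add (contDiff_const.mul hs))
    fun x => by positivity)).exp

/-- This bound blows up as `ε → 0` when `a > 0`; it serves only to make the weighted integrals
converge. -/
theorem abs_expWeight_le (ha : 0 ≤ a) (hε : 0 < ε) (x : Rd d) :
    |expWeight a ε x| ≤ Real.exp (a * ε⁻¹) := by
  rw [abs_of_pos (expWeight_pos x), expWeight]
  gcongr
  rw [div_le_iff₀ (by positivity)]
  have : 0 < ε⁻¹ := by positivity
  calc √(1 + ‖x‖ ^ 2) = ε⁻¹ * (ε * √(1 + ‖x‖ ^ 2)) := by field_simp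
    _ ≤ _ := by gcongr; linarith

/-- This bound is uniform in `ε`, from `√(1 + |x|²) ≤ 1 + |x|`. It controls the weight on a fixed
ball and against the exponential weight on `ψ`. -/
theorem expWeight_le (ha : 0 ≤ a) (hε : 0 < ε) (x : Rd d) :
    expWeight a ε x ≤ Real.exp (a * (1 + ‖x‖)) := by
  rw [expWeight]
  gcongr
  refine (div_le_self (by positivity) (le_add_of_nonneg_right (by positivity))).trans ?_
  rw [Real.sqrt_le_left (by positivity)]
  nlinarith [norm_nonneg x]

/-- The function `t/(1 + εt)` has derivative `(1 + εt)⁻² ≤ 1` for `t ≥ 0`, and `s = √(1 + |x|²)` has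
gradient of length `|x|/s ≤ 1`. So the cut-off does not increase the rate `a`. -/
theorem norm_fderiv_expWeight_le (ha : 0 ≤ a) (hε : 0 < ε) (x : Rd d) :
    ‖fderiv ℝ (expWeight a ε) x‖ ≤ a * |expWeight a ε x| := by
  set s : ℝ := √(1 + ‖x‖ ^ 2) with hs
  have hs0 : 0 < s := by positivity
  have hxs : ‖x‖ ≤ s := Real.le_sqrt_of_sq_le (by linarith)
  have h1 : HasFDerivAt (fun x : Rd d => √(1 + ‖x‖ ^ 2))
      ((1 / (2 * s)) • ((2 : ℝ) • innerSL ℝ x)) x := by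
    have := (hasStrictFDerivAt_norm_sq x).hasFDerivAt.const_add 1
    exact (this.sqrt (by positivity)).congr_fderiv (by ext; simp [hs])
  have h2 : HasDerivAt (fun t : ℝ => Real.exp (a * (t / (1 + ε * t))))
      (Real.exp (a * (s / (1 + ε * s))) * (a * (1 / (1 + ε * s) ^ 2))) s := by
    have hd : HasDerivAt (fun t : ℝ => 1 + ε * t) ε s := by
      simpa using ((hasDerivAt_id s).const_mul ε).const_add 1
    have := (((hasDerivAt_id s).div hd (by positivity)).const_mul a).exp
    convert! this using 3
    simp only [id_eq]
    ring
  have h3 : HasFDerivAt (expWeight a ε) _ x :=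
    HasDerivAt.comp_hasFDerivAt (h₂ := fun t : ℝ => Real.exp (a * (t / (1 + ε * t)))) x h2 h1
  rw [h3.fderiv, norm_smul, norm_smul, norm_smul, innerSL_apply_norm,
    abs_of_pos (expWeight_pos x), Real.norm_of_nonneg (by positivity),
    Real.norm_of_nonneg (by positivity), Real.norm_of_nonneg (by positivity)]
  change expWeight a ε x * _ * _ ≤ _
  have h4 : 1 / (1 + ε * s) ^ 2 ≤ 1 := by
    rw [div_le_one (by positivity)]
    exact one_le_pow₀ (le_add_of_nonneg_right (by positivity))
  have h5 : 1 / (2 * s) * (2 * ‖x‖) ≤ 1 := by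
    rw [div_mul_eq_mul_div, div_le_one (by positivity)]
    linarith
  have := (expWeight_pos (a := a) (ε := ε) x).le
  calc expWeight a ε x * (a * (1 / (1 + ε * s) ^ 2)) * (1 / (2 * s) * (2 * ‖x‖))
      ≤ expWeight a ε x * (a * 1) * 1 := by gcongr
    _ = _ := by ring

theorem tendsto_expWeight (a : ℝ) (x : Rd d) :
    Tendsto (fun n : ℕ => expWeight a (1 / ((n : ℝ) + 1)) x) atTop
      (𝓝 (Real.exp (a * √(1 + ‖x‖ ^ 2)))) := by
  have h := tendsto_one_div_add_atTop_nhds_zero_nat (𝕜 := ℝ)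
  have hc : Continuous Real.exp := Real.continuous_exp
  refine (hc.tendsto _).comp (Tendsto.const_mul a ?_)
  have : Tendsto (fun n : ℕ => 1 + 1 / ((n : ℝ) + 1) * √(1 + ‖x‖ ^ 2)) atTop (𝓝 1) := by
    simpa using (h.mul_const (√(1 + ‖x‖ ^ 2))).const_add 1
  have hdiv := (tendsto_const_nhds (x := √(1 + ‖x‖ ^ 2))).div this one_ne_zero
  rwa [div_one] at hdiv

end expWeight

/-! ### Removing the cut-off -/

variable {d : ℕ} {F : Type*} [NormedAddCommGroup F] [NormedSpace ℝ F]

/-- Fatou along `ε = 1/(n + 1)`; the limiting weight `exp(a√(1 + |x|²))` dominates `exp(a|x|)`. -/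
theorem memLp_exp_smul_of_eLpNorm_expWeight_le {a : ℝ} (ha : 0 ≤ a) {φ : Rd d → F}
    (hφ : MemLp φ 2 volume) {B : ENNReal} (hB : B ≠ ⊤)
    (h : ∀ ε : ℝ, 0 < ε → eLpNorm (fun x => expWeight a ε x • φ x) 2 volume ≤ B) :
    MemLp (fun x => Real.exp (a * ‖x‖) • φ x) 2 volume := by
  have hm : ∀ ε : ℝ, 0 < ε → AEStronglyMeasurable (fun x => expWeight a ε x • φ x) volume :=
    fun ε hε => (contDiff_expWeight hε).continuous.aestronglyMeasurable.smul hφ.1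
  have hlim := Lp.eLpNorm_lim_le_liminf_eLpNorm (p := 2) (μ := (volume : Measure (Rd d)))
    (f := fun (n : ℕ) x => expWeight a (1 / ((n : ℝ) + 1)) x • φ x)
    (fun n => hm _ (by positivity)) (fun x => Real.exp (a * √(1 + ‖x‖ ^ 2)) • φ x)
    (ae_of_all _ fun x => (tendsto_expWeight a x).smul_const _)
  have hle : eLpNorm (fun x => Real.exp (a * √(1 + ‖x‖ ^ 2)) • φ x) 2 volume ≤ B :=
    hlim.trans (liminf_le_of_frequently_le'
      (Frequently.of_forall fun n => h _ (by positivity)))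
  refine MemLp.mono (g := fun x => Real.exp (a * √(1 + ‖x‖ ^ 2)) • φ x)
    ⟨?_, hle.trans_lt hB.lt_top⟩ ?_ (ae_of_all _ fun x => ?_)
  · exact AEStronglyMeasurable.smul (by fun_prop) hφ.1
  · exact AEStronglyMeasurable.smul (by fun_prop) hφ.1
  · rw [norm_smul, norm_smul, Real.norm_of_nonneg (by positivity),
      Real.norm_of_nonneg (by positivity)]
    gcongr
    exact Real.le_sqrt_of_sq_le (by linarith)

/-- If the weighted integrals of `T` are nonnegative while `T ≤ -c |φ|² + K |ψ|²` near infinity,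
then `φ` inherits the exponential decay of `ψ`. -/
theorem memLp_exp_smul_of_weighted_integral_nonneg {a c K R : ℝ} (ha : 0 ≤ a) (hc : 0 < c)
    (hK : 0 ≤ K) {φ ψ : Rd d → F} {T : Rd d → ℝ} (hφ : MemLp φ 2 volume) (hT : Integrable T volume)
    (hpos : ∀ ε : ℝ, 0 < ε → 0 ≤ ∫ x, expWeight a ε x ^ 2 * T x)
    (hle : ∀ᵐ x : Rd d, R ≤ ‖x‖ → T x ≤ -c * ‖φ x‖ ^ 2 + K * ‖ψ x‖ ^ 2)
    (hψ : MemLp (fun x => Real.exp (a * ‖x‖) • ψ x) 2 volume) :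
    MemLp (fun x => Real.exp (a * ‖x‖) • φ x) 2 volume := by
  -- `G` is an integrable majorant, independent of `ε`, of `χ²(T + c|φ|²)`. Its first summand
  -- handles `|x| < R`, where `χ ≤ exp(a(1 + R))`; its second handles `|x| ≥ R`, where the factor
  -- `exp(a)²` comes from `expWeight_le`.
  set G : Rd d → ℝ := fun x => Real.exp (a * (1 + R)) ^ 2 * (|T x| + c * ‖φ x‖ ^ 2) +
    K * Real.exp a ^ 2 * ‖Real.exp (a * ‖x‖) • ψ x‖ ^ 2 with hG
  have iφ : Integrable (fun x => ‖φ x‖ ^ 2) volume :=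
    (memLp_two_iff_integrable_sq_norm hφ.1).1 hφ
  have iG : Integrable G volume :=
    ((hT.abs.add (iφ.const_mul c)).const_mul _).add
      (((memLp_two_iff_integrable_sq_norm hψ.1).1 hψ).const_mul _)
  refine memLp_exp_smul_of_eLpNorm_expWeight_le ha hφ
    (B := ENNReal.ofReal ((c⁻¹ * ∫ x, G x) ^ (2 : ℝ)⁻¹)) ENNReal.ofReal_ne_top fun ε hε => ?_
  have hw : Continuous (expWeight (d := d) a ε) := (contDiff_expWeight hε).continuous
  have hw2 : ∀ x : Rd d, ‖expWeight a ε x ^ 2‖ ≤ Real.exp (a * ε⁻¹) ^ 2 := fun x => by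
    rw [norm_pow]
    exact pow_le_pow_left₀ (norm_nonneg _) (abs_expWeight_le ha hε x) 2
  have iT : Integrable (fun x => expWeight a ε x ^ 2 * T x) volume :=
    hT.bdd_mul (hw.pow 2).aestronglyMeasurable (ae_of_all _ hw2)
  have iw : Integrable (fun x => expWeight a ε x ^ 2 * ‖φ x‖ ^ 2) volume :=
    iφ.bdd_mul (hw.pow 2).aestronglyMeasurable (ae_of_all _ hw2)
  have hpt : ∀ᵐ x : Rd d, c * (expWeight a ε x ^ 2 * ‖φ x‖ ^ 2) ≤
      G x - expWeight a ε x ^ 2 * T x := by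
    filter_upwards [hle] with x hx
    have hw0 := (expWeight_pos (a := a) (ε := ε) x).le
    have hwx := expWeight_le ha hε x
    rcases le_or_gt R ‖x‖ with hR | hR
    · have h1 := mul_le_mul_of_nonneg_left (hx hR) (sq_nonneg (expWeight a ε x))
      have h2 : expWeight a ε x ^ 2 * (K * ‖ψ x‖ ^ 2) ≤
          K * Real.exp a ^ 2 * ‖Real.exp (a * ‖x‖) • ψ x‖ ^ 2 := by
        rw [norm_smul, Real.norm_of_nonneg (Real.exp_pos _).le]
        calc expWeight a ε x ^ 2 * (K * ‖ψ x‖ ^ 2)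
            ≤ Real.exp (a * (1 + ‖x‖)) ^ 2 * (K * ‖ψ x‖ ^ 2) := by gcongr
          _ = _ := by rw [mul_add, Real.exp_add, mul_one]; ring
      have h3 : 0 ≤ Real.exp (a * (1 + R)) ^ 2 * (|T x| + c * ‖φ x‖ ^ 2) := by positivity
      simp only [hG]
      linarith
    · have h1 : expWeight a ε x ≤ Real.exp (a * (1 + R)) := hwx.trans (by gcongr)
      have h2 : expWeight a ε x ^ 2 * (|T x| + c * ‖φ x‖ ^ 2) ≤
          Real.exp (a * (1 + R)) ^ 2 * (|T x| + c * ‖φ x‖ ^ 2) := by gcongr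
      have h3 : expWeight a ε x ^ 2 * T x ≤ expWeight a ε x ^ 2 * |T x| := by
        gcongr
        exact le_abs_self _
      have h4 : 0 ≤ K * Real.exp a ^ 2 * ‖Real.exp (a * ‖x‖) • ψ x‖ ^ 2 := by positivity
      simp only [hG]
      linarith
  have hint : ∫ x, expWeight a ε x ^ 2 * ‖φ x‖ ^ 2 ≤ c⁻¹ * ∫ x, G x := by
    rw [le_inv_mul_iff₀ hc, ← integral_const_mul]
    refine (integral_mono_ae (iw.const_mul c) (iG.sub iT) hpt).trans ?_
    rw [integral_sub' iG iT]
    linarith [hpos ε hε]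
  have hmem : MemLp (fun x => expWeight a ε x • φ x) 2 volume := by
    refine (memLp_two_iff_integrable_sq_norm (hw.aestronglyMeasurable.smul hφ.1)).2 ?_
    simpa only [Pi.smul_apply', norm_smul, mul_pow, Real.norm_eq_abs, sq_abs] using iw
  rw [hmem.eLpNorm_eq_integral_rpow_norm two_ne_zero ENNReal.ofNat_ne_top]
  simp only [ENNReal.toReal_ofNat, Real.rpow_two, norm_smul, mul_pow, Real.norm_eq_abs, sq_abs]
  gcongr

end Weights

section Decay

/-! ### Powers of unbounded operators -/

/-- Peels off the innermost factor of `T^(k+1)`, so that an induction hypothesis for `T^k` applies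
to the image under `T`. -/
theorem opPow_succ_apply_eq_zero {H : Type*} [AddCommGroup H] [Module ℂ H] {T : H →ₗ.[ℂ] H}
    {k : ℕ} (φ : (opPow T (k + 1)).domain) (hφ : opPow T (k + 1) φ = 0) :
    ∃ ψ : T.domain, (ψ : H) = φ ∧ ∃ h : T ψ ∈ (opPow T k).domain, opPow T k ⟨T ψ, h⟩ = 0 := by
  obtain ⟨φ, hφd⟩ := φ
  obtain ⟨⟨y, hy, hyφ⟩, hφT⟩ := id hφd
  exact ⟨⟨φ, hφT⟩, rfl, by subst hyφ; exact hy, hφ⟩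

/-! ### The components of the system -/

theorem coeFn_component {d : ℕ} (j : Fin 2) (φ : L2C2 d) :
    component j φ =ᵐ[volume] fun x => φ x j :=
  ContinuousLinearMap.coeFn_compLpL _ φ

theorem component_inclusion {d : ℕ} (i j : Fin 2) (f : L2 d) :
    component i (inclusion j f) = if i = j then f else 0 := by
  apply Lp.ext
  have h : inclusion j f =ᵐ[volume] fun x => f x • (EuclideanSpace.single j (1 : ℂ) : C2) :=
    ContinuousLinearMap.coeFn_compLpL _ f
  filter_upwards [coeFn_component i (inclusion j f), h,
    Lp.coeFn_zero ℂ 2 (volume : Measure (Rd d))] with x h₁ h₂ h₃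
  rw [h₁, h₂]
  split_ifs with hij
  · simp [hij]
  · rw [h₃]
    simp [hij]

theorem component_matrixOp {d : ℕ} (A : Fin 2 → Fin 2 → (L2 d →ₗ.[ℂ] L2 d))
    (φ : (matrixOp A).domain) (i : Fin 2) (h : ∀ j, component j (φ : L2C2 d) ∈ (A i j).domain) :
    component i (matrixOp A φ) = ∑ j, A i j ⟨component j (φ : L2C2 d), h j⟩ := by
  change component i (∑ i, inclusion i (∑ j, A i j ⟨component j (φ : L2C2 d), _⟩)) = _
  rw [map_sum]
  simp only [component_inclusion, Finset.sum_ite_eq, Finset.mem_univ, if_true]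

/-- The first row of the system. -/
theorem coeFn_systemOp_zero {d : ℕ} {μ : ℝ} {U W : Rd d → ℝ} (φ : (systemOp μ U W).domain)
    (h : component 0 (φ : L2C2 d) ∈ (laplacianOp d).domain) :
    ∀ᵐ x, (systemOp μ U W φ : L2C2 d) x 0 = -laplacianOp d ⟨_, h⟩ x +
      μ * (φ : L2C2 d) x 0 + U x * (φ : L2C2 d) x 0 + W x * (φ : L2C2 d) x 1 := by
  have hd := φ.2
  simp only [systemOp, matrixOp, Submodule.mem_iInf, Submodule.mem_comap] at hd
  have e := component_matrixOp _ φ 0 (hd 0)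
  rw [Fin.sum_univ_two] at e
  have e' : component 0 (systemOp μ U W φ) = -laplacianOp d ⟨_, h⟩ +
      (μ : ℂ) • component 0 (φ : L2C2 d) + mulFun U ⟨component 0 (φ : L2C2 d), (hd 0 0).2⟩ +
      mulFun W ⟨component 1 (φ : L2C2 d), hd 0 1⟩ := e
  filter_upwards [coeFn_component 0 (systemOp μ U W φ), coeFn_component 0 (φ : L2C2 d),
    coeFn_component 1 (φ : L2C2 d), coeFn_mulFun U ⟨component 0 (φ : L2C2 d), (hd 0 0).2⟩,
    coeFn_mulFun W ⟨component 1 (φ : L2C2 d), hd 0 1⟩,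
    Lp.coeFn_neg (laplacianOp d ⟨_, h⟩), Lp.coeFn_smul (μ : ℂ) (component 0 (φ : L2C2 d)),
    Lp.coeFn_add (-laplacianOp d ⟨_, h⟩) ((μ : ℂ) • component 0 (φ : L2C2 d)),
    Lp.coeFn_add (-laplacianOp d ⟨_, h⟩ + (μ : ℂ) • component 0 (φ : L2C2 d))
      (mulFun U ⟨component 0 (φ : L2C2 d), (hd 0 0).2⟩),
    Lp.coeFn_add (-laplacianOp d ⟨_, h⟩ + (μ : ℂ) • component 0 (φ : L2C2 d) +
      mulFun U ⟨component 0 (φ : L2C2 d), (hd 0 0).2⟩)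
      (mulFun W ⟨component 1 (φ : L2C2 d), hd 0 1⟩)] with x h₁ h₂ h₃ h₄ h₅ h₆ h₇ h₈ h₉ h₁₀
  rw [← h₁, e', h₁₀, Pi.add_apply, h₉, Pi.add_apply, h₈, Pi.add_apply, h₆, h₇, h₅, h₄,
    Pi.neg_apply, Pi.smul_apply, h₂, h₃, smul_eq_mul]

/-- The second row of the system. -/
theorem coeFn_systemOp_one {d : ℕ} {μ : ℝ} {U W : Rd d → ℝ} (φ : (systemOp μ U W).domain)
    (h : component 1 (φ : L2C2 d) ∈ (laplacianOp d).domain) :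
    ∀ᵐ x, (systemOp μ U W φ : L2C2 d) x 1 = -(W x * (φ : L2C2 d) x 0) +
      (laplacianOp d ⟨_, h⟩ x - μ * (φ : L2C2 d) x 1 - U x * (φ : L2C2 d) x 1) := by
  have hd := φ.2
  simp only [systemOp, matrixOp, Submodule.mem_iInf, Submodule.mem_comap] at hd
  have e := component_matrixOp _ φ 1 (hd 1)
  rw [Fin.sum_univ_two] at e
  have e' : component 1 (systemOp μ U W φ) = -mulFun W ⟨component 0 (φ : L2C2 d), hd 1 0⟩ +
      (laplacianOp d ⟨_, h⟩ - (μ : ℂ) • component 1 (φ : L2C2 d) -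
        mulFun U ⟨component 1 (φ : L2C2 d), (hd 1 1).2⟩) := e
  filter_upwards [coeFn_component 1 (systemOp μ U W φ), coeFn_component 0 (φ : L2C2 d),
    coeFn_component 1 (φ : L2C2 d), coeFn_mulFun U ⟨component 1 (φ : L2C2 d), (hd 1 1).2⟩,
    coeFn_mulFun W ⟨component 0 (φ : L2C2 d), hd 1 0⟩,
    Lp.coeFn_neg (mulFun W ⟨component 0 (φ : L2C2 d), hd 1 0⟩),
    Lp.coeFn_smul (μ : ℂ) (component 1 (φ : L2C2 d)),
    Lp.coeFn_sub (laplacianOp d ⟨_, h⟩) ((μ : ℂ) • component 1 (φ : L2C2 d)),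
    Lp.coeFn_sub (laplacianOp d ⟨_, h⟩ - (μ : ℂ) • component 1 (φ : L2C2 d))
      (mulFun U ⟨component 1 (φ : L2C2 d), (hd 1 1).2⟩),
    Lp.coeFn_add (-mulFun W ⟨component 0 (φ : L2C2 d), hd 1 0⟩)
      (laplacianOp d ⟨_, h⟩ - (μ : ℂ) • component 1 (φ : L2C2 d) -
        mulFun U ⟨component 1 (φ : L2C2 d), (hd 1 1).2⟩)] with x h₁ h₂ h₃ h₄ h₅ h₆ h₇ h₈ h₉ h₁₀
  rw [← h₁, e', h₁₀, Pi.add_apply, h₉, Pi.sub_apply, h₈, Pi.sub_apply, h₆, h₇, Pi.neg_apply,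
    h₅, h₄, Pi.smul_apply, h₂, h₃, smul_eq_mul]

/-! ### Exponential decay -/

/-- The pointwise bound at points where the potentials are small. -/
theorem inner_add_inner_le {μ δ U W a : ℝ} {E : ℂ} (hδ : 0 < δ) (ha : a ^ 2 = μ - |E.re| - 2 * δ)
    (hUW : |U| + |W| ≤ δ) {u v ψ₁ ψ₂ L₁ L₂ : ℂ}
    (h₁ : -L₁ + μ * u + U * u + W * v - E * u = ψ₁)
    (h₂ : -(W * u) + (L₂ - μ * v - U * v) - E * v = ψ₂) :
    inner ℝ u ((a : ℂ) ^ 2 * u - L₁) + inner ℝ v ((a : ℂ) ^ 2 * v - L₂) ≤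
      -(δ / 2) * (‖u‖ ^ 2 + ‖v‖ ^ 2) + (2 * δ)⁻¹ * (‖ψ₁‖ ^ 2 + ‖ψ₂‖ ^ 2) := by
  have hL₁ : L₁ = μ * u + U * u + W * v - E * u - ψ₁ := by rw [← h₁]; ring
  have hL₂ : L₂ = ψ₂ + W * u + μ * v + U * v + E * v := by rw [← h₂]; ring
  -- The real inner product is `Re(ū·)`, so `Im E` drops out. Solving the second row for `L₂` flips
  -- its sign: `E` enters oppositely in the two terms, while the two `W` terms agree and add up.
  have key : inner ℝ u ((a : ℂ) ^ 2 * u - L₁) + inner ℝ v ((a : ℂ) ^ 2 * v - L₂) =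
      (a ^ 2 - μ - U) * (‖u‖ ^ 2 + ‖v‖ ^ 2) + E.re * (‖u‖ ^ 2 - ‖v‖ ^ 2) -
        2 * W * inner ℝ u v + (inner ℝ u ψ₁ - inner ℝ v ψ₂) := by
    subst hL₁ hL₂
    simp only [Complex.inner, Complex.sq_norm, Complex.normSq_apply, ← Complex.ofReal_pow,
      Complex.mul_re, Complex.sub_re, Complex.add_re, Complex.conj_re,
      Complex.conj_im, Complex.mul_im, Complex.sub_im, Complex.add_im, Complex.ofReal_re,
      Complex.ofReal_im]
    ring
  have hE : E.re * (‖u‖ ^ 2 - ‖v‖ ^ 2) ≤ |E.re| * (‖u‖ ^ 2 + ‖v‖ ^ 2) := by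
    nlinarith [le_abs_self E.re, neg_abs_le E.re, sq_nonneg ‖u‖, sq_nonneg ‖v‖]
  have hU : -U * (‖u‖ ^ 2 + ‖v‖ ^ 2) ≤ |U| * (‖u‖ ^ 2 + ‖v‖ ^ 2) := by
    gcongr
    exact neg_le_abs U
  have hW : -(2 * W * inner ℝ u v) ≤ |W| * (‖u‖ ^ 2 + ‖v‖ ^ 2) := by
    calc -(2 * W * inner ℝ u v) ≤ |2 * W * inner ℝ u v| := neg_le_abs _
      _ = |W| * (2 * |inner ℝ u v|) := by rw [abs_mul, abs_mul, abs_two]; ring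
      _ ≤ |W| * (2 * (‖u‖ * ‖v‖)) := by gcongr; exact abs_real_inner_le_norm u v
      _ ≤ _ := by gcongr; nlinarith [sq_nonneg (‖u‖ - ‖v‖)]
  -- The coefficient of `|u|² + |v|²` available is `a² - μ + |Re E| + |U| + |W| ≤ -2δ + δ = -δ`.
  -- Young spends half of it on the `ψ` terms, leaving `-δ/2`.
  have young : ∀ p q : ℝ, p * q ≤ δ / 2 * p ^ 2 + (2 * δ)⁻¹ * q ^ 2 := fun p q => by
    have : δ / 2 * p ^ 2 + (2 * δ)⁻¹ * q ^ 2 - p * q = (2 * δ)⁻¹ * (δ * p - q) ^ 2 := by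
      field_simp
      ring
    have h0 : 0 ≤ (2 * δ)⁻¹ * (δ * p - q) ^ 2 := by positivity
    linarith
  have hψ₁ : inner ℝ u ψ₁ ≤ ‖u‖ * ‖ψ₁‖ := real_inner_le_norm u ψ₁
  have hψ₂ : -inner ℝ v ψ₂ ≤ ‖v‖ * ‖ψ₂‖ := by
    rw [← inner_neg_right, ← norm_neg ψ₂]
    exact real_inner_le_norm v (-ψ₂)
  have hUW' := mul_le_mul_of_nonneg_right hUW (by positivity : 0 ≤ ‖u‖ ^ 2 + ‖v‖ ^ 2)
  rw [key, ha]
  linarith [young ‖u‖ ‖ψ₁‖, young ‖v‖ ‖ψ₂‖]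

theorem TendsToZeroAtInfinity.exists_radius {d : ℕ} {X : Rd d → ℝ} (hX : TendsToZeroAtInfinity X)
    {η : ℝ} (hη : 0 < η) : ∃ R : ℝ, ∀ᵐ x : Rd d, R ≤ ‖x‖ → |X x| ≤ η := by
  have h : ∀ᶠ x in cocompact (Rd d) ⊓ ae volume, |X x| ≤ η := by
    filter_upwards [hX (Metric.closedBall_mem_nhds 0 hη)] with x hx
    simpa using hx
  rw [eventually_inf] at h
  obtain ⟨s, hs, t, ht, hst⟩ := h
  obtain ⟨R, hR⟩ := Metric.closedBall_compl_subset_of_mem_cocompact hs 0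
  -- The cocompact set contains only the complement of the closed ball, so `|x| > R` must be strict.
  refine ⟨R + 1, ?_⟩
  filter_upwards [ht] with x hx hxR
  refine hst x ⟨hR ?_, hx⟩
  simp only [Set.mem_compl_iff, Metric.mem_closedBall, dist_zero_right, not_le]
  linarith

/-- If `(ℋ - E) φ` decays exponentially, then so does `φ`. -/
theorem memLp_exp_smul_of_systemOp_sub {d : ℕ} {μ : ℝ} {U W : Rd d → ℝ}
    (hU : IsLaplacianBoundedWithBoundZero U) (hW : IsLaplacianBoundedWithBoundZero W)
    (hU₀ : TendsToZeroAtInfinity U) (hW₀ : TendsToZeroAtInfinity W) {E : ℂ}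
    {δ a : ℝ} (hδ : 0 < δ) (ha : 0 ≤ a) (ha₂ : a ^ 2 = μ - |E.re| - 2 * δ)
    (φ : (systemOp μ U W - scalarOp (L2C2 d) E).domain)
    (hψ : MemLp (fun x => Real.exp (a * ‖x‖) •
      ((systemOp μ U W - scalarOp (L2C2 d) E) φ : L2C2 d) x) 2 volume) :
    MemLp (fun x => Real.exp (a * ‖x‖) • (φ : L2C2 d) x) 2 volume := by
  set ψ : L2C2 d := (systemOp μ U W - scalarOp (L2C2 d) E) φ
  let φ' : (systemOp μ U W).domain := ⟨φ, φ.2.1⟩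
  have hsub : ψ = systemOp μ U W φ' - E • (φ : L2C2 d) := rfl
  obtain ⟨h₀, h₁⟩ := (mem_systemOp_domain μ hU hW (φ : L2C2 d)).1 φ.2.1
  let g : Fin 2 → (laplacianOp d).domain := ![⟨_, h₀⟩, ⟨_, h₁⟩]
  have hg : ∀ j, (g j : L2 d) =ᵐ[volume] fun x => (φ : L2C2 d) x j := by
    intro j
    fin_cases j
    · exact coeFn_component 0 _
    · exact coeFn_component 1 _
  let T : Fin 2 → Rd d → ℝ := fun j x =>
    inner ℝ ((g j : L2 d) x) ((a : ℂ) ^ 2 * (g j : L2 d) x - laplacianOp d (g j) x)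
  have hmem : ∀ j, MemLp (fun x => (a : ℂ) ^ 2 * (g j : L2 d) x - laplacianOp d (g j) x) 2 volume :=
    fun j => ((Lp.memLp (g j : L2 d)).const_mul _).sub (Lp.memLp _)
  have iT : ∀ j, Integrable (T j) volume := fun j => by
    simpa only [one_mul] using integrable_mul_inner (m := fun _ => 1) (C := 1) continuous_const (by simp)
      (Lp.memLp (g j : L2 d)) (hmem j)
  obtain ⟨R₁, hR₁⟩ := hU₀.exists_radius (half_pos hδ)
  obtain ⟨R₂, hR₂⟩ := hW₀.exists_radius (half_pos hδ)
  refine memLp_exp_smul_of_weighted_integral_nonneg (c := δ / 2) (K := (2 * δ)⁻¹)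
    (R := max R₁ R₂) (T := fun x => T 0 x + T 1 x) (ψ := ψ) ha (half_pos hδ) (by positivity)
    (Lp.memLp _) ((iT 0).add (iT 1)) (fun ε hε => ?_) ?_ hψ
  · have hw := contDiff_expWeight (d := d) (a := a) hε
    have hb := abs_expWeight_le (d := d) ha hε
    have i : ∀ j, Integrable (fun x => expWeight a ε x ^ 2 * T j x) volume := fun j =>
      integrable_mul_inner (m := fun x => expWeight a ε x ^ 2) (C := Real.exp (a * ε⁻¹) ^ 2)
        (hw.continuous.pow 2)
        (fun x => by rw [abs_pow]; exact pow_le_pow_left₀ (abs_nonneg _) (hb x) 2)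
        (Lp.memLp _) (hmem j)
    simp only [mul_add]
    rw [integral_add (i 0) (i 1)]
    have hnn := fun j => weighted_form_nonneg hw hb (norm_fderiv_expWeight_le ha hε) (g j)
    exact add_nonneg (hnn 0) (hnn 1)
  · filter_upwards [hR₁, hR₂, hg 0, hg 1, coeFn_systemOp_zero φ' h₀, coeFn_systemOp_one φ' h₁,
      Lp.coeFn_sub (systemOp μ U W φ') (E • (φ : L2C2 d)),
      Lp.coeFn_smul E (φ : L2C2 d)] with x hx₁ hx₂ hg₀ hg₁ hs₀ hs₁ hsub' hsmul hxR
    have hUW : |U x| + |W x| ≤ δ := by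
      linarith [hx₁ ((le_max_left _ _).trans hxR), hx₂ ((le_max_right _ _).trans hxR)]
    have hψx : ∀ j, ψ x j = (systemOp μ U W φ' : L2C2 d) x j - E * (φ : L2C2 d) x j := fun j => by
      rw [hsub, hsub', Pi.sub_apply, hsmul]
      simp
    have e₀ := hψx 0
    have e₁ := hψx 1
    rw [hs₀] at e₀
    rw [hs₁] at e₁
    simp only [EuclideanSpace.norm_sq_eq, Fin.sum_univ_two, T, hg₀, hg₁]
    exact inner_add_inner_le hδ ha₂ hUW e₀.symm e₁.symm

end Decay

end

end MatrixSchrodinger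

theorem theorem2 {d : ℕ} (μ : ℝ) (hμ : 0 < μ) (U W : MatrixSchrodinger.Rd d → ℝ)
    (hU : MatrixSchrodinger.IsLaplacianBoundedWithBoundZero U)
    (hW : MatrixSchrodinger.IsLaplacianBoundedWithBoundZero W)
    (hU₀ : MatrixSchrodinger.TendsToZeroAtInfinity U)
    (hW₀ : MatrixSchrodinger.TendsToZeroAtInfinity W)
    (E : ℂ) (hE : MatrixSchrodinger.IsEigenvalue (MatrixSchrodinger.systemOp μ U W) E)
    (hE₁ : -μ < E.re) (hE₂ : E.re < μ)
    (k : ℕ)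
    (φ : (MatrixSchrodinger.opPow (MatrixSchrodinger.systemOp μ U W -
      MatrixSchrodinger.scalarOp (MatrixSchrodinger.L2C2 d) E) k).domain)
    (hφ : MatrixSchrodinger.opPow (MatrixSchrodinger.systemOp μ U W -
      MatrixSchrodinger.scalarOp (MatrixSchrodinger.L2C2 d) E) k φ = 0)
    (δ : ℝ) (hδ₀ : 0 < δ) (hδ : δ < (μ - |E.re|) / 2) :
    MeasureTheory.MemLp
      (fun x : MatrixSchrodinger.Rd d =>
        Real.exp (Real.sqrt (μ - |E.re| - 2 * δ) * ‖x‖) • (φ : MatrixSchrodinger.L2C2 d) x)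
      2 MeasureTheory.volume := by
  have h2δ : 0 < μ - |E.re| - 2 * δ := by linarith
  -- The rate stays fixed throughout: `(ℋ - E)φ` is annihilated by the lower power, hence decays at
  -- this rate, and passes it to `φ`. The base case is `φ = 0`.
  induction k with
  | zero =>
    have h0 : (φ : MatrixSchrodinger.L2C2 d) = 0 := hφ
    refine (MeasureTheory.memLp_congr_ae ?_).2
      (MeasureTheory.MemLp.zero (ε := MatrixSchrodinger.C2) (p := 2))
    rw [h0]
    filter_upwards [MeasureTheory.Lp.coeFn_zero MatrixSchrodinger.C2 2
      (MeasureTheory.volume : MeasureTheory.Measure (MatrixSchrodinger.Rd d))] with x hx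
    rw [hx, Pi.zero_apply, smul_zero]
  | succ k ih =>
    obtain ⟨ψ, hψφ, hψ, hψ0⟩ := MatrixSchrodinger.opPow_succ_apply_eq_zero φ hφ
    rw [← hψφ]
    exact MatrixSchrodinger.memLp_exp_smul_of_systemOp_sub hU hW hU₀ hW₀ hδ₀ (Real.sqrt_nonneg _)
      (Real.sq_sqrt h2δ.le) ψ (ih ⟨_, hψ⟩ hψ0)
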